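/- Let $\gamma,\omega_0,\omega_p\in\mathbb R$ (damping, resonance frequency, coupling strength) with $\gamma^2\neq 4\omega_0^2$, and let $$\sigma_\pm=-\tfrac12\gamma\pm\sqrt{\tfrac14\gamma^2-\omega_0^2}\in\mathbb C$$ be the two (hence distinct) roots of $\sigma^2+\gamma\sigma+\omega_0^2$. Let $M_X\times M_Y$ be the product of two copies of the spacetime $\mathbb R^4$, with coordinates $x=(x^0,\mathbf x)$ and $y=(y^0,\mathbf y)$, where $\mathbf x=(x^1,x^2,x^3)$ and $\mathbf y=(y^1,y^2,y^3)$. Repeated indices are summed over, with $a,b,c,d\in\{0,1,2,3\}$ and $\lambda,\nu,\rho\in\{1,2,3\}$; $\epsilon$ is the Levi-Civita symbol with $\epsilon_{0123}=\epsilon_{123}=1$; and $\theta$ is the Heaviside function. Consider the following 4-forms on $M_X\times M_Y$ whose coefficients are complex-valued distributions: $$\Delta=\tfrac14\,\epsilon_{abcd}\,\delta^{(4)}(x-y)\,dx^a\wedge dx^b\wedge dy^c\wedge dy^d ,$$ $$\kappa=\omega_p^2\,\frac{\theta(x^0-y^0)\,\delta^{(3)}(\mathbf x-\mathbf y)}{2(\sigma_+-\sigma_-)}\left[e^{\sigma_+(x^0-y^0)}-e^{\sigma_-(x^0-y^0)}\right]\epsilon_{\lambda\nu\rho}\,dx^0\wedge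 dx^\lambda\wedge dy^\nu\wedge dy^\rho .$$ Define the operators $\Psi_X=L_{x^0}^2+\gamma L_{x^0}+\omega_0^2$ and $\Phi_X=\omega_p^2\,dx^0\wedge i_{x^0}$, where $i_{x^0}$ is the internal contraction with the vector field $\partial/\partial x^0$ on $M_X\times M_Y$ and $L_{x^0}=d\,i_{x^0}+i_{x^0}\,d$ is the Lie derivative along it, derivatives of coefficients being taken in the sense of distributions. Then $$\Psi_X\,\kappa=\Phi_X\,\Delta .$$ -/

import Mathlib

open MeasureTheory TopologicalSpace
open scoped Distributions LineDeriv

namespace GreenKernel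

noncomputable section

/-! ### Spacetime, its square, and constant forms -/

/-- Spacetime in global coordinates `x = (x⁰, x¹, x², x³)`, where `x⁰` is the time. -/
abbrev Spacetime : Type := Fin 4 → ℝ

/-- The product `M_X × M_Y` of two copies of spacetime; its points are the pairs `(x, y)`. -/
abbrev Pairs : Type := Spacetime × Spacetime

/-- The coordinate vector field `∂/∂xᵃ` on `M_X × M_Y`. -/
def vecX (a : Fin 4) : Pairs := (Pi.single a 1, 0)

/-- The coordinate vector field `∂/∂yᵃ` on `M_X × M_Y`. -/
def vecY (a : Fin 4) : Pairs := (0, Pi.single a 1)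

/-- The coordinate one-form `dxᵃ` on `M_X × M_Y`. -/
def dx (a : Fin 4) : Pairs →L[ℝ] ℝ :=
  (ContinuousLinearMap.proj a).comp (ContinuousLinearMap.fst ℝ Spacetime Spacetime)

/-- The coordinate one-form `dyᵃ` on `M_X × M_Y`. -/
def dy (a : Fin 4) : Pairs →L[ℝ] ℝ :=
  (ContinuousLinearMap.proj a).comp (ContinuousLinearMap.snd ℝ Spacetime Spacetime)

/-- Complex-valued alternating `k`-forms on the tangent space of `M_X × M_Y`. -/
abbrev Forms (k : ℕ) : Type := Pairs [⋀^Fin k]→L[ℝ] ℂ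

/-- The wedge product `α ∧ ω` of a one-form with a `k`-form, as a linear map in `ω`:
`(α ∧ ω)(v₀, …, v_k) = ∑ᵢ (-1)ⁱ α(vᵢ) ω(v₀, …, v̂ᵢ, …, v_k)`. -/
def wedge (α : Pairs →L[ℝ] ℝ) (k : ℕ) : Forms k →L[ℝ] Forms (k + 1) :=
  (ContinuousAlternatingMap.alternatizeUncurryFinCLM ℝ Pairs ℂ).comp
    (ContinuousLinearMap.smulRightL ℝ Pairs (Forms k) α)

/-- The internal contraction `i_v`, `(i_v ω)(v₁, …, v_k) = ω(v, v₁, …, v_k)`. -/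
def contract (v : Pairs) (k : ℕ) : Forms (k + 1) →L[ℝ] Forms k :=
  (ContinuousLinearMap.apply ℝ (Forms k) v).comp
    (ContinuousAlternatingMap.curryLeftLI (𝕜 := ℝ) (E := Pairs) (F := ℂ)
      (n := k)).toContinuousLinearMap

/-- The constant form `dxᵃ ∧ dxᵇ ∧ dyᶜ ∧ dyᵈ`. -/
def dxdxdydy (a b c d : Fin 4) : Forms 4 :=
  wedge (dx a) 3 (wedge (dx b) 2 (wedge (dy c) 1 (wedge (dy d) 0
    (ContinuousAlternatingMap.constOfIsEmpty ℝ Pairs (Fin 0) (1 : ℂ)))))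

/-- The Levi-Civita symbol `ε_{i₀ i₁ …} = ∏_{r < s} sgn (i_s - i_r)`, with `ε_{0 1 2 …} = 1`. -/
def leviCivita {n : ℕ} (i : Fin n → Fin n) : ℤ :=
  ∏ r : Fin n, ∏ s ∈ Finset.univ.filter (fun s => r < s), Int.sign ((i s : ℤ) - (i r : ℤ))

/-! ### Form-valued distributions on `M_X × M_Y` and the operators acting on them -/

/-- Distributional `k`-forms on `M_X × M_Y`: distributions with values in the `k`-forms, i.e.
forms whose coefficients are complex distributions on `M_X × M_Y`. -/
abbrev DistForm (k : ℕ) : Type := 𝓓'((⊤ : Opens Pairs), Forms k)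

/-- The distributional form `S ω` with a scalar distribution `S` and a constant form `ω`. -/
def coeffMul {k : ℕ} (S : 𝓓'((⊤ : Opens Pairs), ℂ)) (ω : Forms k) : DistForm k :=
  Distribution.mapCLM (((1 : ℂ →L[ℂ] ℂ).smulRight ω).restrictScalars ℝ) S

/-- The exterior derivative `d T = ∑ₐ (dxᵃ ∧ ∂T/∂xᵃ + dyᵃ ∧ ∂T/∂yᵃ)`, with distributional
partial derivatives of the coefficients. -/
def extD {k : ℕ} (T : DistForm k) : DistForm (k + 1) :=
  ∑ a : Fin 4, (Distribution.mapCLM (wedge (dx a) k) (∂_{vecX a} T)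
    + Distribution.mapCLM (wedge (dy a) k) (∂_{vecY a} T))

/-- The internal contraction of a distributional form with a constant vector field. -/
def interior {k : ℕ} (v : Pairs) (T : DistForm (k + 1)) : DistForm k :=
  Distribution.mapCLM (contract v k) T

/-- The Lie derivative along a constant vector field, `L_v = d i_v + i_v d`. -/
def lie {k : ℕ} (v : Pairs) (T : DistForm (k + 1)) : DistForm (k + 1) :=
  extD (interior v T) + interior v (extD T)

/-- The operator `Ψ_X = L_{x⁰}² + γ L_{x⁰} + ω₀²`. -/
def PsiX {k : ℕ} (γ ω₀ : ℝ) (T : DistForm (k + 1)) : DistForm (k + 1) :=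
  lie (vecX 0) (lie (vecX 0) T) + γ • lie (vecX 0) T + ω₀ ^ 2 • T

/-- The operator `Φ_X = ω_p² dx⁰ ∧ i_{x⁰}`. -/
def PhiX {k : ℕ} (ωp : ℝ) (T : DistForm (k + 1)) : DistForm (k + 1) :=
  ωp ^ 2 • Distribution.mapCLM (wedge (dx 0) k) (interior (vecX 0) T)

/-! ### The scalar distributions `δ⁽⁴⁾(x - y)` and `θ(x⁰ - y⁰) f(x⁰ - y⁰) δ⁽³⁾(x - y)` -/

/-- Integration over a closed, continuously embedded piece of `M_X × M_Y`, against a continuous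
density cut off to a closed set, depends continuously on the test function. -/
theorem continuous_integral_embedding {M : Type*} [TopologicalSpace M] [MeasurableSpace M]
    [BorelSpace M] (μ : Measure M) [IsFiniteMeasureOnCompacts μ] {ι : M → Pairs}
    (hι : Topology.IsClosedEmbedding ι) {G : Pairs → ℂ} (hG : Continuous G) {S : Set Pairs}
    (hS : IsClosed S) :
    Continuous (fun φ : 𝓓((⊤ : Opens Pairs), ℝ) =>
      ∫ m, (φ (ι m) : ℂ) * S.indicator G (ι m) ∂μ) := by
  have hfin : IsFiniteMeasureOnCompacts (μ.map ι) := ⟨fun K hK => by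
    rw [Measure.map_apply hι.continuous.measurable hK.measurableSet]
    exact (hι.isCompact_preimage hK).measure_lt_top⟩
  have hloc : LocallyIntegrableOn (S.indicator G) ((⊤ : Opens Pairs) : Set Pairs) (μ.map ι) :=
    ((hG.locallyIntegrable (μ := μ.map ι)).indicator hS.measurableSet).locallyIntegrableOn _
  have h := (TestFunction.integralAgainstBilinCLM (n := ⊤) (Ω := (⊤ : Opens Pairs))
    (ContinuousLinearMap.lsmul ℝ ℝ : ℝ →L[ℝ] ℂ →L[ℝ] ℂ) (μ.map ι) (S.indicator G)).continuous
  refine h.congr fun φ => ?_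
  rw [TestFunction.integralAgainstBilinCLM_eq_integral hloc,
    hι.measurableEmbedding.integral_map]
  simp

/-- The diagonal `x ↦ (x, x)`. -/
def diag (x : Spacetime) : Pairs := (x, x)

theorem isClosedEmbedding_diag : Topology.IsClosedEmbedding diag :=
  Topology.IsClosedEmbedding.of_continuous_injective_isClosedMap (by unfold diag; fun_prop)
    (fun _ _ h => congrArg Prod.fst h) (by
      have : Function.LeftInverse (Prod.fst : Pairs → Spacetime) diag := fun _ => rfl
      exact (this.isClosedEmbedding continuous_fst (by unfold diag; fun_prop)).isClosedMap)

/-- The distribution `δ⁽⁴⁾(x - y)`: `φ ↦ ∫ φ(x, x) d⁴x`. -/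
def deltaFour : 𝓓'((⊤ : Opens Pairs), ℂ) where
  toFun φ := ∫ x : Spacetime, (φ (x, x) : ℂ)
  map_add' φ ψ := by
    have hi (χ : 𝓓((⊤ : Opens Pairs), ℝ)) :
        Integrable (fun x : Spacetime => (χ (x, x) : ℂ)) :=
      Continuous.integrable_of_hasCompactSupport
        (Complex.continuous_ofReal.comp (χ.continuous.comp isClosedEmbedding_diag.continuous))
        ((χ.hasCompactSupport.comp_isClosedEmbedding isClosedEmbedding_diag).comp_left
          Complex.ofReal_zero)
    rw [← integral_add (hi φ) (hi ψ)]
    simp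
  map_smul' c φ := by
    simp [integral_const_mul]
  cont := by
    refine (continuous_integral_embedding (volume : Measure Spacetime) isClosedEmbedding_diag
      (G := fun _ => 1) continuous_const isClosed_univ).congr fun φ => ?_
    simp [diag]

/-- The parametrisation `(t, s, z) ↦ ((t, z), (s, z))` of the set of pairs of events with the
same spatial position. -/
def sameSite (p : ℝ × ℝ × (Fin 3 → ℝ)) : Pairs :=
  (Fin.cons p.1 p.2.2, Fin.cons p.2.1 p.2.2)

theorem isClosedEmbedding_sameSite : Topology.IsClosedEmbedding sameSite := by
  have hc : Continuous sameSite := by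
    unfold sameSite
    refine Continuous.prodMk (continuous_pi fun i => ?_) (continuous_pi fun i => ?_) <;>
    · refine Fin.cases ?_ (fun j => ?_) i
      · simp only [Fin.cons_zero]; fun_prop
      · simp only [Fin.cons_succ]; fun_prop
  have hinv : Function.LeftInverse
      (fun q : Pairs => (q.1 0, q.2 0, fun j : Fin 3 => q.1 j.succ)) sameSite := fun _ => rfl
  exact hinv.isClosedEmbedding (by fun_prop) hc

/-- The Heaviside function (its value at `0` plays no role). -/
def heaviside (t : ℝ) : ℂ := if 0 ≤ t then 1 else 0

theorem continuous_retarded {f : ℝ → ℂ} (hf : Continuous f) :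
    Continuous (fun φ : 𝓓((⊤ : Opens Pairs), ℝ) => ∫ p : ℝ × ℝ × (Fin 3 → ℝ),
      heaviside (p.1 - p.2.1) * f (p.1 - p.2.1) * (φ (sameSite p) : ℂ)) := by
  have hG : Continuous (fun q : Pairs => f (q.1 0 - q.2 0)) := by fun_prop
  have hS : IsClosed {q : Pairs | 0 ≤ q.1 0 - q.2 0} :=
    isClosed_le continuous_const (by fun_prop)
  refine (continuous_integral_embedding volume isClosedEmbedding_sameSite hG hS).congr
    fun φ => integral_congr_ae (Filter.Eventually.of_forall fun p => ?_)
  simp only [Set.indicator_apply, Set.mem_ofPred_eq, heaviside, sameSite, Fin.cons_zero]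
  split_ifs <;> ring

theorem integrable_retarded {f : ℝ → ℂ} (hf : Continuous f) (φ : 𝓓((⊤ : Opens Pairs), ℝ)) :
    Integrable (fun p : ℝ × ℝ × (Fin 3 → ℝ) =>
      heaviside (p.1 - p.2.1) * f (p.1 - p.2.1) * (φ (sameSite p) : ℂ)) := by
  have h : Integrable (fun p : ℝ × ℝ × (Fin 3 → ℝ) =>
      f (p.1 - p.2.1) * (φ (sameSite p) : ℂ)) :=
    Continuous.integrable_of_hasCompactSupport
      ((hf.comp (by fun_prop)).mul (Complex.continuous_ofReal.comp
        (φ.continuous.comp isClosedEmbedding_sameSite.continuous)))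
      (((φ.hasCompactSupport.comp_isClosedEmbedding isClosedEmbedding_sameSite).comp_left
        Complex.ofReal_zero).mul_left)
  have hS : MeasurableSet {p : ℝ × ℝ × (Fin 3 → ℝ) | 0 ≤ p.1 - p.2.1} :=
    (isClosed_le continuous_const (by fun_prop)).measurableSet
  refine (h.indicator hS).congr (Filter.Eventually.of_forall fun p => ?_)
  simp only [Set.indicator_apply, Set.mem_ofPred_eq, heaviside]
  split_ifs <;> ring

/-- The distribution `θ(x⁰ - y⁰) f(x⁰ - y⁰) δ⁽³⁾(x - y)` for a continuous `f`, where `δ⁽³⁾`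
involves the spatial parts:
`φ ↦ ∫∫∫ θ(t - s) f(t - s) φ((t, z), (s, z)) dt ds d³z`. -/
def retarded (f : ℝ → ℂ) (hf : Continuous f) : 𝓓'((⊤ : Opens Pairs), ℂ) where
  toFun φ := ∫ p : ℝ × ℝ × (Fin 3 → ℝ),
    heaviside (p.1 - p.2.1) * f (p.1 - p.2.1) * (φ (sameSite p) : ℂ)
  map_add' φ ψ := by
    rw [← integral_add (integrable_retarded hf φ) (integrable_retarded hf ψ)]
    simp [mul_add]
  map_smul' c φ := by
    simp only [FunLike.coe_smul, Pi.smul_apply, smul_eq_mul, Complex.ofReal_mul,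
      RingHom.id_apply, Complex.real_smul]
    rw [← integral_const_mul]
    exact integral_congr_ae (Filter.Eventually.of_forall fun p => by ring)
  cont := continuous_retarded hf

/-! ### The four-form `Δ` and the kernel `κ` -/

/-- `Δ = ¼ ε_{abcd} δ⁽⁴⁾(x - y) dxᵃ ∧ dxᵇ ∧ dyᶜ ∧ dyᵈ`. -/
def Delta : DistForm 4 :=
  (1 / 4 : ℝ) • ∑ a : Fin 4, ∑ b : Fin 4, ∑ c : Fin 4, ∑ d : Fin 4,
    (leviCivita ![a, b, c, d] : ℝ) • coeffMul deltaFour (dxdxdydy a b c d)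

/-- The root `σ₊ = -γ/2 + √(γ²/4 - ω₀²)` of `σ² + γ σ + ω₀²` (complex square root). -/
def sigmaPlus (γ ω₀ : ℝ) : ℂ :=
  -(1 / 2) * (γ : ℂ) + ((1 / 4) * (γ : ℂ) ^ 2 - (ω₀ : ℂ) ^ 2) ^ (1 / 2 : ℂ)

/-- The root `σ₋ = -γ/2 - √(γ²/4 - ω₀²)` of `σ² + γ σ + ω₀²` (complex square root). -/
def sigmaMinus (γ ω₀ : ℝ) : ℂ :=
  -(1 / 2) * (γ : ℂ) - ((1 / 4) * (γ : ℂ) ^ 2 - (ω₀ : ℂ) ^ 2) ^ (1 / 2 : ℂ)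

/-- The function `τ ↦ (e^{σ₊ τ} - e^{σ₋ τ}) / (2 (σ₊ - σ₋))`, meant for `σ₊ ≠ σ₋`. -/
def profile (γ ω₀ : ℝ) (τ : ℝ) : ℂ :=
  (Complex.exp (sigmaPlus γ ω₀ * τ) - Complex.exp (sigmaMinus γ ω₀ * τ)) /
    (2 * (sigmaPlus γ ω₀ - sigmaMinus γ ω₀))

theorem continuous_profile (γ ω₀ : ℝ) : Continuous (profile γ ω₀) := by
  unfold profile
  fun_prop

/-- The kernel `κ = ω_p² θ(x⁰ - y⁰) δ⁽³⁾(x - y) (e^{σ₊(x⁰ - y⁰)} - e^{σ₋(x⁰ - y⁰)}) / (2(σ₊ - σ₋))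
ε_{λνρ} dx⁰ ∧ dx^λ ∧ dy^ν ∧ dy^ρ`; the spatial indices `1, 2, 3` are the successors of the
elements of `Fin 3`. -/
def kappa (γ ω₀ ωp : ℝ) : DistForm 4 :=
  ωp ^ 2 • ∑ l : Fin 3, ∑ n : Fin 3, ∑ r : Fin 3,
    (leviCivita ![l, n, r] : ℝ) • coeffMul (retarded (profile γ ω₀) (continuous_profile γ ω₀))
      (dxdxdydy 0 l.succ n.succ r.succ)

end

end GreenKernel

/-!
The operators `L_{x⁰}` and `dx⁰ ∧ i_{x⁰}` separate into an action on coefficients and an action on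
constant forms. By Cartan's formula (`lie_eq_lineDeriv`), which rests on the antiderivation property
`contract_wedge`, the Lie derivative along a constant vector field only differentiates coefficients.
Hence `Ψ_X κ` is the constant form `ω_p² ε_{λνρ} dx⁰ ∧ dx^λ ∧ dy^ν ∧ dy^ρ` times the damped oscillator
operator applied to the retarded coefficient. Integration by parts in `x⁰` gives the jump formula
`∂(θ f δ⁽³⁾) = f(0) δ⁽⁴⁾ + θ f' δ⁽³⁾` (`lineDeriv_retarded`); applied to the exponentials with exponents
`σ₊` and `σ₋`, it shows that the oscillator operator yields `½ δ⁽⁴⁾(x - y)`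
(`oscillator_retarded_profile`).

On the other side, `dx⁰ ∧ i_{x⁰}` keeps from `¼ ε_{abcd} dxᵃ ∧ dxᵇ ∧ dyᶜ ∧ dyᵈ` the terms with `a = 0` or
`b = 0`. These contribute equally, and leave `½ ε_{λνρ} dx⁰ ∧ dx^λ ∧ dy^ν ∧ dy^ρ`
(`projection_constant_form`), so both sides are the same form.
-/

namespace GreenKernel

open LineDeriv

/-! ### Interior and exterior multiplication of constant forms -/

/-- The interior product is an antiderivation: `i_v (α ∧ ω) = α(v) ω - α ∧ i_v ω`. -/
theorem contract_wedge (v : Pairs) (α : Pairs →L[ℝ] ℝ) (k : ℕ) (ω : Forms (k + 1)) :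
    contract v (k + 1) (wedge α (k + 1) ω) = α v • ω - wedge α k (contract v k ω) := by
  have h (i : Fin (k + 1)) (m : Fin (k + 1) → Pairs) :
      i.succ.removeNth (Matrix.vecCons v m) = Matrix.vecCons v (i.removeNth m) := by
    ext1 j
    refine Fin.cases ?_ (fun j => ?_) j <;> simp [Fin.removeNth_apply]
  ext m
  simp [contract, wedge, Fin.sum_univ_succ (n := k + 1), h, pow_succ,
    ContinuousAlternatingMap.alternatizeUncurryFin_apply, sub_eq_add_neg]

theorem contract_wedge_zero (v : Pairs) (α : Pairs →L[ℝ] ℝ) (ω : Forms 0) :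
    contract v 0 (wedge α 0 ω) = α v • ω := by
  ext m
  simp [contract, wedge, ContinuousAlternatingMap.alternatizeUncurryFin_apply]

theorem wedge_complex_smul (α : Pairs →L[ℝ] ℝ) (k : ℕ) (z : ℂ) (ω : Forms k) :
    wedge α k (z • ω) = z • wedge α k ω := by
  ext m
  simp [wedge, ContinuousAlternatingMap.alternatizeUncurryFin_apply, Finset.mul_sum,
    mul_left_comm]

theorem contract_complex_smul (v : Pairs) (k : ℕ) (z : ℂ) (ω : Forms (k + 1)) :
    contract v k (z • ω) = z • contract v k ω := rfl

/-! ### Cartan's formula for constant vector fields -/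

/-- The expansion of a constant vector field in the coordinate frame. -/
theorem sum_dx_vecX_add_dy_vecY (v : Pairs) :
    ∑ a : Fin 4, (dx a v • vecX a + dy a v • vecY a) = v := by
  ext i <;> simp [dx, dy, vecX, vecY, Prod.fst_sum, Prod.snd_sum, Finset.sum_apply, Pi.single_apply]

theorem lie_apply {k : ℕ} (v : Pairs) (T : DistForm (k + 1)) (φ : 𝓓((⊤ : Opens Pairs), ℝ)) :
    lie v T φ = T (-∂_{v} φ) := by
  have hT : T (-∂_{v} φ) = ∑ a : Fin 4,
      (dx a v • T (-∂_{vecX a} φ) + dy a v • T (-∂_{vecY a} φ)) := by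
    conv_lhs => rw [← sum_dx_vecX_add_dy_vecY v]
    rw [LineDeriv.lineDerivOp_left_sum, ← Finset.sum_neg_distrib, map_sum]
    refine Finset.sum_congr rfl fun a _ => ?_
    rw [lineDerivOp_left_add, lineDerivOp_left_smul, lineDerivOp_left_smul, neg_add,
      ← smul_neg, ← smul_neg, map_add, map_smul, map_smul]
  have hd (R : DistForm (k + 2)) : interior v R φ = contract v (k + 1) (R φ) := rfl
  have hi (w : Pairs) : (∂_{w} (interior v T)) φ = contract v k (T (-∂_{w} φ)) := by
    rw [Distribution.lineDerivOp_apply_apply]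
    rfl
  rw [hT, lie, add_apply, hd, extD, extD]
  simp only [sum_apply, add_apply, Distribution.mapCLM_apply,
    hi, map_sum, map_add, contract_wedge, Distribution.lineDerivOp_apply_apply]
  rw [← Finset.sum_add_distrib]
  refine Finset.sum_congr rfl fun a _ => ?_
  abel

/-- Cartan's formula: along a constant vector field, `L_v = d i_v + i_v d` merely differentiates the
coefficients, because the antiderivation property cancels every other term. -/
theorem lie_eq_lineDeriv {k : ℕ} (v : Pairs) (T : DistForm (k + 1)) : lie v T = ∂_{v} T := by
  ext φ : 1
  simp [lie_apply]

/-! ### The Levi-Civita symbol and the projection of the constant form -/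

theorem leviCivita_three (a b c : Fin 3) :
    leviCivita ![a, b, c] = Int.sign (b - a : ℤ) * Int.sign (c - a : ℤ) * Int.sign (c - b : ℤ) := by
  simp [leviCivita, Finset.prod_filter, Fin.prod_univ_succ]

theorem leviCivita_four (a b c d : Fin 4) :
    leviCivita ![a, b, c, d] = Int.sign (b - a : ℤ) * Int.sign (c - a : ℤ) * Int.sign (d - a : ℤ)
      * (Int.sign (c - b : ℤ) * Int.sign (d - b : ℤ) * Int.sign (d - c : ℤ)) := by
  simp [leviCivita, Finset.prod_filter, Fin.prod_univ_succ, mul_assoc]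

theorem leviCivita_swap (a b c d : Fin 4) :
    leviCivita ![b, a, c, d] = -leviCivita ![a, b, c, d] := by
  rw [leviCivita_four, leviCivita_four, ← neg_sub (b : ℤ) a, Int.sign_neg]
  ring

theorem leviCivita_zero_succ (l n r : Fin 3) :
    leviCivita ![0, l.succ, n.succ, r.succ] = leviCivita ![l, n, r] := by
  have h (j : Fin 3) : Int.sign ((j : ℤ) + 1) = 1 := Int.sign_eq_one_of_pos (by positivity)
  simp [leviCivita_four, leviCivita_three, h]

/-- The general `zero_smul` does not unify on `Forms k`: the scalar actions agree only after
unfolding beyond reducible transparency. -/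
theorem Forms.zero_smul {k : ℕ} (ω : Forms k) : (0 : ℝ) • ω = 0 := by
  ext m
  simp

/-- The general `two_smul` does not unify on `Forms k`, for the same reason as `zero_smul`. -/
theorem Forms.two_smul {k : ℕ} (ω : Forms k) : (2 : ℝ) • ω = ω + ω := by
  ext m
  simp [two_mul]

/-- `dx⁰ ∧ i_{x⁰}` moves a factor `dx⁰` of the form to the front; the minus sign comes from moving
it past `dxᵃ`. -/
theorem wedge_contract_dxdxdydy (a b c d : Fin 4) :
    wedge (dx 0) 3 (contract (vecX 0) 3 (dxdxdydy a b c d)) =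
      (if a = 0 then dxdxdydy 0 b c d else 0) - (if b = 0 then dxdxdydy 0 a c d else 0) := by
  have hx (a : Fin 4) : dx a (vecX 0) = if a = 0 then 1 else 0 := by
    simp [dx, vecX, Pi.single_apply]
  have hy (a : Fin 4) : dy a (vecX 0) = 0 := by simp [dy, vecX]
  simp only [dxdxdydy, contract_wedge, contract_wedge_zero, hx, hy]
  split_ifs <;> simp [Forms.zero_smul]

/-- The projection `dx⁰ ∧ i_{x⁰}` keeps from `ε_{abcd} dxᵃ ∧ dxᵇ ∧ dyᶜ ∧ dyᵈ` the terms with `a = 0` and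
those with `b = 0`; by antisymmetry both families have the same sum, whence the factor `2`. -/
theorem projection_constant_form :
    wedge (dx 0) 3 (contract (vecX 0) 3 (∑ a : Fin 4, ∑ b : Fin 4, ∑ c : Fin 4, ∑ d : Fin 4,
      (leviCivita ![a, b, c, d] : ℝ) • dxdxdydy a b c d)) =
    (2 : ℝ) • ∑ l : Fin 3, ∑ n : Fin 3, ∑ r : Fin 3,
      (leviCivita ![l, n, r] : ℝ) • dxdxdydy 0 l.succ n.succ r.succ := by
  have h0 : ∀ b c d : Fin 4, b = 0 ∨ c = 0 ∨ d = 0 → leviCivita ![0, b, c, d] = 0 := by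
    rintro b c d (rfl | rfl | rfl) <;> simp [leviCivita_four]
  have hA : ∑ b : Fin 4, ∑ c : Fin 4, ∑ d : Fin 4,
      (leviCivita ![0, b, c, d] : ℝ) • dxdxdydy 0 b c d = ∑ l : Fin 3, ∑ n : Fin 3, ∑ r : Fin 3,
      (leviCivita ![l, n, r] : ℝ) • dxdxdydy 0 l.succ n.succ r.succ := by
    simp only [Fin.sum_univ_succ (n := 3), h0, leviCivita_zero_succ, true_or, or_true, Int.cast_zero,
      Forms.zero_smul, Finset.sum_const_zero, zero_add]
  simp only [map_sum, map_smul, wedge_contract_dxdxdydy, smul_sub, Finset.sum_sub_distrib]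
  rw [← hA, Forms.two_smul, sub_eq_add_neg]
  -- The two summands come from `a = 0` and from `b = 0`.
  congr 1
  · rw [Finset.sum_eq_single 0] <;> simp +contextual
  · rw [← Finset.sum_neg_distrib]
    refine Finset.sum_congr rfl fun a _ => ?_
    rw [Finset.sum_eq_single 0] <;> simp +contextual [leviCivita_swap 0 a]

/-! ### The jump formula for retarded distributions -/

/-- Moving the time of the first event along `sameSite` is moving along `∂/∂x⁰`. -/
theorem hasDerivAt_testFunction_time (φ : 𝓓((⊤ : Opens Pairs), ℝ)) (t s : ℝ) (z : Fin 3 → ℝ) :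
    HasDerivAt (fun t => φ (sameSite (t, s, z))) ((∂_{vecX 0} φ) (sameSite (t, s, z))) t := by
  have h1 : (∂_{vecX 0} φ) (sameSite (t, s, z)) = fderiv ℝ φ (sameSite (t, s, z)) (vecX 0) := by
    rw [TestFunction.lineDerivOp_eq_lineDerivCLM ℝ, TestFunction.lineDerivCLM_apply_of_le le_top,
      (φ.contDiff.differentiable (by simp)).differentiableAt.lineDeriv_eq_fderiv]
  have h2 : HasDerivAt (fun t => sameSite (t, s, z)) (vecX 0) t := by
    refine HasDerivAt.prodMk (hasDerivAt_pi.2 fun i => ?_)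
      (hasDerivAt_const t (Fin.cons s z : Spacetime))
    refine Fin.cases ?_ (fun j => ?_) i
    · simpa using hasDerivAt_id' t
    · simpa using hasDerivAt_const t (z j)
  rw [h1]
  exact ((φ.contDiff.differentiable (by simp)).differentiableAt.hasFDerivAt
    (x := sameSite (t, s, z))).comp_hasDerivAt t h2

/-- Integration by parts in the first time `t`, at a fixed second time `s` and site `z`: the cut-off at
`t = s` leaves the boundary term `-f(0) φ`. -/
theorem integral_mul_deriv_retarded {f f' : ℝ → ℂ} (hf : ∀ τ, HasDerivAt f (f' τ) τ)
    (hf' : Continuous f') (φ : 𝓓((⊤ : Opens Pairs), ℝ)) (s : ℝ) (z : Fin 3 → ℝ) :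
    ∫ t : ℝ, (heaviside (t - s) * f (t - s) * ((∂_{vecX 0} φ) (sameSite (t, s, z)) : ℂ)
      + heaviside (t - s) * f' (t - s) * (φ (sameSite (t, s, z)) : ℂ)) =
    -(f 0 * (φ (sameSite (s, s, z)) : ℂ)) := by
  have hfc : Continuous f := continuous_iff_continuousAt.2 fun τ => (hf τ).continuousAt
  have hι : Topology.IsClosedEmbedding (fun t : ℝ => sameSite (t, s, z)) := by
    refine isClosedEmbedding_sameSite.comp ?_
    have hl : Function.LeftInverse (Prod.fst : ℝ × ℝ × (Fin 3 → ℝ) → ℝ) (fun t => (t, s, z)) :=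
      fun _ => rfl
    exact hl.isClosedEmbedding continuous_fst (by fun_prop)
  have hcont (ψ : 𝓓((⊤ : Opens Pairs), ℝ)) :
      Continuous (fun t : ℝ => (ψ (sameSite (t, s, z)) : ℂ)) :=
    Complex.continuous_ofReal.comp (ψ.continuous.comp hι.continuous)
  have hsupp (ψ : 𝓓((⊤ : Opens Pairs), ℝ)) :
      HasCompactSupport (fun t : ℝ => (ψ (sameSite (t, s, z)) : ℂ)) :=
    (ψ.hasCompactSupport.comp_isClosedEmbedding hι).comp_left Complex.ofReal_zero
  -- The integrand is the derivative of `g`, cut off to `[s, ∞)`.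
  set g : ℝ → ℂ := fun t => f (t - s) * (φ (sameSite (t, s, z)) : ℂ)
  have hg (t : ℝ) : HasDerivAt g (f (t - s) * ((∂_{vecX 0} φ) (sameSite (t, s, z)) : ℂ)
      + f' (t - s) * (φ (sameSite (t, s, z)) : ℂ)) t := by
    have h := ((hf (t - s)).comp_sub_const t s).mul
      (hasDerivAt_testFunction_time φ t s z).ofReal_comp
    rw [add_comm]
    exact h
  have hgs : HasCompactSupport g := (hsupp φ).mul_left
  have hderiv : deriv g = fun t => f (t - s) * ((∂_{vecX 0} φ) (sameSite (t, s, z)) : ℂ)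
      + f' (t - s) * (φ (sameSite (t, s, z)) : ℂ) := funext fun t => (hg t).deriv
  have hg1 : ContDiff ℝ 1 g := by
    refine contDiff_one_iff_deriv.2 ⟨fun t => (hg t).differentiableAt, ?_⟩
    rw [hderiv]
    have := hcont φ
    have := hcont (∂_{vecX 0} φ)
    fun_prop
  have key := hgs.integral_Ioi_deriv_eq hg1 s
  rw [← integral_Ici_eq_integral_Ioi, ← integral_indicator measurableSet_Ici, hderiv] at key
  refine Eq.trans (integral_congr_ae (Filter.Eventually.of_forall fun t => ?_))
    (key.trans (by simp [g]))
  simp only [Set.indicator_apply, Set.mem_Ici, heaviside, sub_nonneg]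
  split_ifs <;> ring

/-- At equal times `sameSite` parametrises the diagonal of `M_X × M_Y`, so that `δ(x⁰ - y⁰) δ⁽³⁾` is
`δ⁽⁴⁾(x - y)`. -/
theorem integral_sameSite_diagonal (φ : 𝓓((⊤ : Opens Pairs), ℝ)) :
    ∫ p : ℝ × (Fin 3 → ℝ), (φ (sameSite (p.1, p.1, p.2)) : ℂ) = deltaFour φ := by
  have h := ((volume_preserving_piFinSuccAbove (fun _ : Fin 4 => ℝ) 0).symm).integral_comp'
    (fun x : Spacetime => (φ (x, x) : ℂ))
  refine Eq.trans ?_ h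
  refine integral_congr_ae (Filter.Eventually.of_forall fun p => ?_)
  simp [sameSite, MeasurableEquiv.piFinSuccAbove_symm_apply, Fin.insertNthEquiv]

/-- The jump formula `∂(θ f δ⁽³⁾)/∂x⁰ = f(0) δ⁽⁴⁾ + θ f' δ⁽³⁾`. -/
theorem lineDeriv_retarded {f f' : ℝ → ℂ} (hf : ∀ τ, HasDerivAt f (f' τ) τ)
    (hfc : Continuous f) (hf' : Continuous f') (φ : 𝓓((⊤ : Opens Pairs), ℝ)) :
    (∂_{vecX 0} (retarded f hfc)) φ = f 0 * deltaFour φ + retarded f' hf' φ := by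
  have h : retarded f hfc (∂_{vecX 0} φ) + retarded f' hf' φ = -(f 0 * deltaFour φ) := by
    have hi1 := integrable_retarded hfc (∂_{vecX 0} φ)
    have hi2 := integrable_retarded hf' φ
    change (∫ p : ℝ × ℝ × (Fin 3 → ℝ), _) + (∫ p : ℝ × ℝ × (Fin 3 → ℝ), _) = _
    rw [← integral_add hi1 hi2, Measure.volume_eq_prod]
    refine (integral_prod_symm _ (hi1.add hi2)).trans ?_
    simp only [Pi.add_apply, integral_mul_deriv_retarded hf hf']
    rw [integral_neg, integral_const_mul, integral_sameSite_diagonal]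
  rw [Distribution.lineDerivOp_apply_apply, map_neg]
  linear_combination -h

/-! ### The retarded Green function of the damped oscillator -/

theorem sigma_sq_add {γ ω₀ : ℝ} {σ : ℂ} (hσ : σ = sigmaPlus γ ω₀ ∨ σ = sigmaMinus γ ω₀) :
    σ ^ 2 + γ * σ + ω₀ ^ 2 = 0 := by
  have hr : (((1 / 4) * (γ : ℂ) ^ 2 - (ω₀ : ℂ) ^ 2) ^ (1 / 2 : ℂ)) ^ 2 =
      (1 / 4) * (γ : ℂ) ^ 2 - (ω₀ : ℂ) ^ 2 := by
    rw [one_div (2 : ℂ)]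
    exact_mod_cast Complex.cpow_nat_inv_pow _ two_ne_zero
  rcases hσ with rfl | rfl <;> simp only [sigmaPlus, sigmaMinus] <;> linear_combination hr

theorem sigmaPlus_sub_sigmaMinus_ne_zero {γ ω₀ : ℝ} (hne : γ ^ 2 ≠ 4 * ω₀ ^ 2) :
    sigmaPlus γ ω₀ - sigmaMinus γ ω₀ ≠ 0 := by
  intro h
  have hp := sigma_sq_add (γ := γ) (ω₀ := ω₀) (Or.inl rfl)
  have hs : sigmaPlus γ ω₀ + sigmaMinus γ ω₀ = -γ := by
    simp only [sigmaPlus, sigmaMinus]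
    ring
  have h2 : sigmaPlus γ ω₀ = -γ / 2 := by linear_combination (h + hs) / 2
  rw [h2] at hp
  apply hne
  have : (γ : ℂ) ^ 2 = 4 * (ω₀ : ℂ) ^ 2 := by linear_combination -4 * hp
  exact_mod_cast this

theorem hasDerivAt_exp_mul (σ : ℂ) (τ : ℝ) :
    HasDerivAt (fun τ : ℝ => Complex.exp (σ * τ)) (σ * Complex.exp (σ * τ)) τ := by
  have h : HasDerivAt (fun τ : ℝ => σ * (τ : ℂ)) (σ * 1) τ :=
    Complex.ofRealCLM.hasDerivAt.const_mul σ
  simpa [mul_comm] using h.cexp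

/-- The scalar coefficient `S` of `κ`, without the factor `ω_p²`, is one half of the retarded
Green function of the damped oscillator: `∂²S + γ ∂S + ω₀² S = ½ δ⁽⁴⁾(x - y)`, with `∂ = ∂/∂x⁰`. -/
theorem oscillator_retarded_profile {γ ω₀ : ℝ} (hne : γ ^ 2 ≠ 4 * ω₀ ^ 2)
    (φ : 𝓓((⊤ : Opens Pairs), ℝ)) :
    let S := retarded (profile γ ω₀) (continuous_profile γ ω₀)
    (∂_{vecX 0} (∂_{vecX 0} S)) φ + γ * (∂_{vecX 0} S) φ + ω₀ ^ 2 * S φ = 1 / 2 * deltaFour φ := by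
  intro S
  set p := sigmaPlus γ ω₀
  set m := sigmaMinus γ ω₀
  have hpm : p - m ≠ 0 := sigmaPlus_sub_sigmaMinus_ne_zero hne
  have hE (σ : ℂ) : Continuous fun τ : ℝ => Complex.exp (σ * τ) := by fun_prop
  -- `S` is a difference of retarded exponentials `E σ`, and `∂(E σ) = δ⁽⁴⁾ + σ E σ`; the deltas cancel
  -- in `∂S`, while in `∂²S` they come with the total weight `(σ₊ - σ₋) / (2 (σ₊ - σ₋)) = ½`.
  set E : ℂ → 𝓓'((⊤ : Opens Pairs), ℂ) := fun σ => retarded (fun τ => Complex.exp (σ * τ)) (hE σ)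
  have hdE (σ : ℂ) (ψ : 𝓓((⊤ : Opens Pairs), ℝ)) :
      E σ (-∂_{vecX 0} ψ) = deltaFour ψ + σ * E σ ψ := by
    have h := lineDeriv_retarded (hasDerivAt_exp_mul σ) (hE σ) (by fun_prop) ψ
    rw [Distribution.lineDerivOp_apply_apply] at h
    refine h.trans ?_
    congr 1
    · simp
    · change (∫ p : ℝ × ℝ × (Fin 3 → ℝ), _) = σ * (∫ p : ℝ × ℝ × (Fin 3 → ℝ), _)
      rw [← integral_const_mul]
      exact integral_congr_ae (Filter.Eventually.of_forall fun p => by ring)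
  have hS (ψ : 𝓓((⊤ : Opens Pairs), ℝ)) : S ψ = (E p ψ - E m ψ) / (2 * (p - m)) := by
    change (∫ p : ℝ × ℝ × (Fin 3 → ℝ), _) =
      ((∫ p : ℝ × ℝ × (Fin 3 → ℝ), _) - (∫ p : ℝ × ℝ × (Fin 3 → ℝ), _)) / _
    rw [← integral_sub (integrable_retarded (hE p) ψ) (integrable_retarded (hE m) ψ),
      ← integral_div]
    refine integral_congr_ae (Filter.Eventually.of_forall fun q => ?_)
    simp only [profile]
    ring
  simp only [Distribution.lineDerivOp_apply_apply, hS, hdE]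
  have hp : p ^ 2 + γ * p + ω₀ ^ 2 = 0 := sigma_sq_add (Or.inl rfl)
  have hm : m ^ 2 + γ * m + ω₀ ^ 2 = 0 := sigma_sq_add (Or.inr rfl)
  field_simp
  linear_combination E p φ * hp - E m φ * hm

/-! ### The two sides of the identity -/

theorem coeffMul_apply {k : ℕ} (S : 𝓓'((⊤ : Opens Pairs), ℂ)) (ω : Forms k)
    (φ : 𝓓((⊤ : Opens Pairs), ℝ)) : coeffMul S ω φ = S φ • ω := rfl

theorem kappa_apply (γ ω₀ ωp : ℝ) (φ : 𝓓((⊤ : Opens Pairs), ℝ)) :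
    kappa γ ω₀ ωp φ = retarded (profile γ ω₀) (continuous_profile γ ω₀) φ • ωp ^ 2 •
      ∑ l : Fin 3, ∑ n : Fin 3, ∑ r : Fin 3,
        (leviCivita ![l, n, r] : ℝ) • dxdxdydy 0 l.succ n.succ r.succ := by
  ext m
  simp [kappa, coeffMul_apply, Finset.mul_sum, mul_left_comm]

theorem Delta_apply (φ : 𝓓((⊤ : Opens Pairs), ℝ)) :
    Delta φ = deltaFour φ • (1 / 4 : ℝ) • ∑ a : Fin 4, ∑ b : Fin 4, ∑ c : Fin 4, ∑ d : Fin 4,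
      (leviCivita ![a, b, c, d] : ℝ) • dxdxdydy a b c d := by
  ext m
  simp [Delta, coeffMul_apply, Finset.mul_sum, mul_left_comm]

theorem PsiX_apply {k : ℕ} (γ ω₀ : ℝ) (T : DistForm (k + 1)) (φ : 𝓓((⊤ : Opens Pairs), ℝ)) :
    PsiX γ ω₀ T φ = T (-∂_{vecX 0} (-∂_{vecX 0} φ)) + γ • T (-∂_{vecX 0} φ) + ω₀ ^ 2 • T φ := by
  simp only [PsiX, lie_eq_lineDeriv, add_apply, smul_apply, Distribution.lineDerivOp_apply_apply]

theorem PhiX_Delta_apply (ωp : ℝ) (φ : 𝓓((⊤ : Opens Pairs), ℝ)) :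
    PhiX ωp Delta φ = (1 / 2 * deltaFour φ) • ωp ^ 2 •
      ∑ l : Fin 3, ∑ n : Fin 3, ∑ r : Fin 3,
        (leviCivita ![l, n, r] : ℝ) • dxdxdydy 0 l.succ n.succ r.succ := by
  have h : PhiX ωp Delta φ = ωp ^ 2 • wedge (dx 0) 3 (contract (vecX 0) 3 (Delta φ)) := rfl
  rw [h, Delta_apply, contract_complex_smul, wedge_complex_smul, map_smul, map_smul,
    projection_constant_form]
  ext m
  simp only [ContinuousAlternatingMap.smul_apply, smul_eq_mul, Complex.real_smul]
  push_cast
  ring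

theorem PsiX_kappa_apply {γ ω₀ : ℝ} (ωp : ℝ) (hne : γ ^ 2 ≠ 4 * ω₀ ^ 2)
    (φ : 𝓓((⊤ : Opens Pairs), ℝ)) :
    PsiX γ ω₀ (kappa γ ω₀ ωp) φ = (1 / 2 * deltaFour φ) • ωp ^ 2 •
      ∑ l : Fin 3, ∑ n : Fin 3, ∑ r : Fin 3,
        (leviCivita ![l, n, r] : ℝ) • dxdxdydy 0 l.succ n.succ r.succ := by
  -- `PsiX_apply` speaks of `DistForm (3 + 1)`; the rewriting below needs the literal degree `4`.
  have h : (PsiX γ ω₀ (kappa γ ω₀ ωp) : DistForm 4) φ =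
      kappa γ ω₀ ωp (-∂_{vecX 0} (-∂_{vecX 0} φ)) + γ • kappa γ ω₀ ωp (-∂_{vecX 0} φ)
        + ω₀ ^ 2 • kappa γ ω₀ ωp φ := PsiX_apply γ ω₀ (kappa γ ω₀ ωp) φ
  refine h.trans ?_
  rw [← oscillator_retarded_profile hne φ]
  simp only [kappa_apply, Distribution.lineDerivOp_apply_apply]
  ext m
  simp only [ContinuousAlternatingMap.add_apply, ContinuousAlternatingMap.smul_apply,
    smul_eq_mul, Complex.real_smul]
  push_cast
  ring

end GreenKernel

theorem mainTheorem5 (γ ω₀ ωp : ℝ) (hne : γ ^ 2 ≠ 4 * ω₀ ^ 2) :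
    GreenKernel.PsiX γ ω₀ (GreenKernel.kappa γ ω₀ ωp) = GreenKernel.PhiX ωp GreenKernel.Delta := by
  ext φ : 1
  exact (GreenKernel.PsiX_kappa_apply ωp hne φ).trans (GreenKernel.PhiX_Delta_apply ωp φ).symm
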